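/- Let $(X,d)$ be a complete metric space that is * Busemann concave: $X$ is geodesic, and for all constant speed geodesics $\gamma,\eta:[0,1]\to X$ with $\gamma(0)=\eta(0)$ the function $t\mapsto d(\gamma(t),\eta(t))$ is concave on $[0,1]$; and * locally doubling: for every $z\in X$ there are $R>0$ and $N\in\mathbb{N}$ such that for all $y\in B_R(z)$ and $0<r\le R$ the ball $B_r(y)$ can be covered by at most $N$ balls of radius $r/2$. Fix $x\in X$. Let $\Gamma_x$ be the set of maximal unit speed geodesics starting at $x$, i.e. maps $\gamma:I\to X$ on an interval $I\subset[0,\infty)$ containing $0$ with $\gamma(0)=x$ and $d(\gamma(s),\gamma(t))=|s-t|$ for $s,t\in I$ that have no proper extension of the same kind. The pre-tangent cone $\hat T_xX$ is $\Gamma_x\times[0,\infty)$ with all points $(\gamma,0)$ identified to one point $o$, with the distance $$d_x((\gamma,s),(\eta,t))=\sup\Big\{\tfrac1r\,d(\gamma(rs),\eta(rt)) : r\in(0,1],\ \gamma(rs)\text{ and }\eta(rt)\text{ are defined}\Big\},$$ and the tangent cone $(T_xX,d_x)$ is the metric completion of $(\hat T_xX,d_x)$ (if $X=\{x\}$, it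 is a single point). Say that pointed metric spaces $(X_i,d_i,x_i)$ converge to $(Y,d_Y,y)$ in the pointed Gromov–Hausdorff sense if for every $r>0$ the Gromov–Hausdorff distance of the pointed balls $(B_r(x_i),x_i)$ and $(B_r(y),y)$ tends to $0$; here the Gromov–Hausdorff distance of two pointed metric spaces is the infimum of the Hausdorff distances of their images over all pairs of isometric embeddings into a common metric space that send the two base points to the same point. Then: 1. $(T_xX,d_x)$ is locally compact. 2. $(X,\frac1\lambda d,x)$ converges to $(T_xX,d_x,o)$ in the pointed Gromov–Hausdorff sense as $\lambda\to0^+$. 3. The limit is unique: if $\lambda_n>0$, $\lambda_n\to0$ and $(X,\frac1{\lambda_n}d,x)$ converges in the pointed Gromov–Hausdorff sense to a complete pointed metric space $(Y,d_Y,y)$, then there is a surjective isometry $T_xX\to Y$ that maps $o$ to $y$. -/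

import Mathlib

open Set Filter Topology
open scoped NNReal ENNReal

universe u v

namespace BusemannTangent

/-! ### Busemann concave spaces and local doubling -/

/-- `γ`, restricted to `[0,1]`, is a constant speed geodesic from `x` to `y`. -/
structure IsGeodesic {X : Type u} [MetricSpace X] (γ : ℝ → X) (x y : X) : Prop where
  source : γ 0 = x
  target : γ 1 = y
  dist_eq : ∀ s ∈ Icc (0 : ℝ) 1, ∀ t ∈ Icc (0 : ℝ) 1, dist (γ s) (γ t) = |s - t| * dist x y

/-- A geodesic metric space such that `t ↦ d(γ t, η t)` is concave on `[0,1]` for any two constant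
speed geodesics `γ`, `η` with the same initial point. -/
class IsBusemannConcave (X : Type u) [MetricSpace X] : Prop where
  exists_geodesic : ∀ x y : X, ∃ γ : ℝ → X, IsGeodesic γ x y
  concaveOn : ∀ (x y₁ y₂ : X) (γ η : ℝ → X), IsGeodesic γ x y₁ → IsGeodesic η x y₂ →
    ConcaveOn ℝ (Icc (0 : ℝ) 1) fun t => dist (γ t) (η t)

/-- Every point `x` has a radius `R` and a number `N` such that each ball with center in `B_R(x)`
and radius `r ≤ R` is covered by at most `N` balls of radius `r / 2`. -/
def IsLocallyDoubling (X : Type u) [MetricSpace X] : Prop :=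
  ∀ x : X, ∃ R : ℝ, 0 < R ∧ ∃ N : ℕ, ∀ y ∈ Metric.ball x R, ∀ r : ℝ, 0 < r → r ≤ R →
    ∃ s : Finset X, s.card ≤ N ∧ Metric.ball y r ⊆ ⋃ z ∈ s, Metric.ball z (r / 2)

/-! ### Unit speed geodesics from a point -/

/-- A unit speed geodesic starting at `x`, defined on an interval `dom` of one of the forms `[0,a]`,
`[0,a)`, `[0,∞)`. Outside `dom` the function is set to the value `x`, so that two geodesics are
equal iff their domains agree and they agree on it. -/
@[ext]
structure UnitSpeedGeodesic {X : Type u} [MetricSpace X] (x : X) where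
  dom : Set ℝ
  toFun : ℝ → X
  ordConnected : dom.OrdConnected
  zero_mem : (0 : ℝ) ∈ dom
  nonneg : ∀ t ∈ dom, 0 ≤ t
  map_zero : toFun 0 = x
  dist_eq : ∀ s ∈ dom, ∀ t ∈ dom, dist (toFun s) (toFun t) = |s - t|
  outside : ∀ t, t ∉ dom → toFun t = x

namespace UnitSpeedGeodesic

variable {X : Type u} [MetricSpace X] {x : X}

/-- `η` extends `γ`. -/
def Extends (η γ : UnitSpeedGeodesic x) : Prop :=
  γ.dom ⊆ η.dom ∧ EqOn η.toFun γ.toFun γ.dom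

/-- `γ` has no proper extension to a unit speed geodesic starting at `x`. -/
def IsMaximal (γ : UnitSpeedGeodesic x) : Prop :=
  ∀ η : UnitSpeedGeodesic x, η.Extends γ → η = γ

theorem mem_of_le (γ : UnitSpeedGeodesic x) {s t : ℝ} (ht : t ∈ γ.dom) (hs : 0 ≤ s)
    (hst : s ≤ t) : s ∈ γ.dom :=
  γ.ordConnected.out γ.zero_mem ht ⟨hs, hst⟩

theorem dist_base (γ : UnitSpeedGeodesic x) {s : ℝ} (hs : s ∈ γ.dom) :
    dist x (γ.toFun s) = s := by
  have h := γ.dist_eq 0 γ.zero_mem s hs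
  rwa [γ.map_zero, zero_sub, abs_neg, abs_of_nonneg (γ.nonneg s hs)] at h

theorem Extends.antisymm {γ η : UnitSpeedGeodesic x} (h : η.Extends γ) (h' : γ.Extends η) :
    η = γ := by
  have hd : η.dom = γ.dom := Subset.antisymm h'.1 h.1
  refine UnitSpeedGeodesic.ext hd (funext fun t => ?_)
  by_cases ht : t ∈ γ.dom
  · exact h.2 ht
  · rw [γ.outside t ht, η.outside t (by rwa [hd])]

variable (x) in
theorem exists_isMaximal : ∃ γ : UnitSpeedGeodesic x, γ.IsMaximal := by
  classical
  have key : ∃ m : UnitSpeedGeodesic x, ∀ a, a.Extends m → m.Extends a := by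
    refine exists_maximal_of_chains_bounded (r := fun γ η => Extends η γ) ?_ ?_
    · intro c hc
      have hcomp : ∀ γ ∈ c, ∀ η ∈ c, γ.Extends η ∨ η.Extends γ := by
        intro γ hγ η hη
        by_cases h : γ = η
        · subst h; exact Or.inl ⟨Subset.rfl, fun _ _ => rfl⟩
        · exact (hc hγ hη h).symm
      have hagree : ∀ γ ∈ c, ∀ η ∈ c, ∀ t, t ∈ γ.dom → t ∈ η.dom → γ.toFun t = η.toFun t := by
        intro γ hγ η hη t h1 h2
        rcases hcomp γ hγ η hη with h | h
        · exact h.2 h2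
        · exact (h.2 h1).symm
      let f : ℝ → X := fun t => if h : ∃ γ ∈ c, t ∈ γ.dom then h.choose.toFun t else x
      have hf : ∀ γ ∈ c, ∀ t ∈ γ.dom, f t = γ.toFun t := by
        intro γ hγ t ht
        have h : ∃ γ ∈ c, t ∈ γ.dom := ⟨γ, hγ, ht⟩
        simp only [f, dif_pos h]
        exact hagree _ h.choose_spec.1 _ hγ t h.choose_spec.2 ht
      have hboth : ∀ γ ∈ c, ∀ η ∈ c, ∀ s ∈ γ.dom, ∀ t ∈ η.dom,
          ∃ ζ ∈ c, s ∈ ζ.dom ∧ t ∈ ζ.dom := by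
        intro γ hγ η hη s hs t ht
        rcases hcomp γ hγ η hη with h | h
        · exact ⟨γ, hγ, hs, h.1 ht⟩
        · exact ⟨η, hη, h.1 hs, ht⟩
      refine ⟨⟨{t | t = 0 ∨ ∃ γ ∈ c, t ∈ γ.dom}, f, ⟨?_⟩, Or.inl rfl, ?_, ?_, ?_, ?_⟩,
        fun γ hγ => ⟨fun t ht => Or.inr ⟨γ, hγ, ht⟩, fun t ht => hf γ hγ t ht⟩⟩
      · rintro s hs t (rfl | ⟨γ, hγ, ht⟩) r hr
        · have hs0 : 0 ≤ s := by
            rcases hs with rfl | ⟨η, _, h⟩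
            · exact le_rfl
            · exact η.nonneg s h
          exact Or.inl (le_antisymm hr.2 (hs0.trans hr.1))
        · have hs0 : 0 ≤ s := by
            rcases hs with rfl | ⟨η, _, h⟩
            · exact le_rfl
            · exact η.nonneg s h
          exact Or.inr ⟨γ, hγ, γ.mem_of_le ht (hs0.trans hr.1) hr.2⟩
      · rintro t (rfl | ⟨γ, _, h⟩)
        · exact le_rfl
        · exact γ.nonneg t h
      · by_cases h : ∃ γ ∈ c, (0 : ℝ) ∈ γ.dom
        · obtain ⟨γ, hγ, h0⟩ := h
          rw [hf γ hγ 0 h0, γ.map_zero]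
        · simp only [f, dif_neg h]
      · by_cases hne : c.Nonempty
        · obtain ⟨ζ, hζ⟩ := hne
          have hmem : ∀ t, (t = 0 ∨ ∃ γ ∈ c, t ∈ γ.dom) → ∃ γ ∈ c, t ∈ γ.dom := by
            rintro t (rfl | h)
            · exact ⟨ζ, hζ, ζ.zero_mem⟩
            · exact h
          intro s hs t ht
          obtain ⟨γ, hγ, hs'⟩ := hmem s hs
          obtain ⟨η, hη, ht'⟩ := hmem t ht
          obtain ⟨ξ, hξ, h1, h2⟩ := hboth γ hγ η hη s hs' t ht'
          rw [hf ξ hξ s h1, hf ξ hξ t h2, ξ.dist_eq s h1 t h2]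
        · have hmem : ∀ t, (t = 0 ∨ ∃ γ ∈ c, t ∈ γ.dom) → t = 0 := by
            rintro t (rfl | ⟨γ, hγ, _⟩)
            · rfl
            · exact absurd ⟨γ, hγ⟩ hne
          intro s hs t ht
          rw [hmem s hs, hmem t ht]; simp
      · intro t ht
        have h : ¬ ∃ γ ∈ c, t ∈ γ.dom := fun h => ht (Or.inr h)
        simp only [f, dif_neg h]
    · intro a b c hab hbc
      exact ⟨hab.1.trans hbc.1, fun t ht => (hbc.2 (hab.1 ht)).trans (hab.2 ht)⟩
  obtain ⟨m, hm⟩ := key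
  exact ⟨m, fun η h => h.antisymm (hm η h)⟩

/-- In a geodesic space with more than one point, maximal geodesics have positive length. -/
theorem IsMaximal.exists_pos [IsBusemannConcave X] {γ : UnitSpeedGeodesic x}
    (hγ : γ.IsMaximal) {y : X} (hy : y ≠ x) : ∃ a ∈ γ.dom, 0 < a := by
  classical
  by_contra hcon
  push Not at hcon
  obtain ⟨c, hc⟩ := IsBusemannConcave.exists_geodesic x y
  have hl : 0 < dist x y := dist_pos.2 hy.symm
  set l := dist x y with hldef
  have hdiv : ∀ t ∈ Icc (0 : ℝ) l, t / l ∈ Icc (0 : ℝ) 1 := fun t ht =>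
    ⟨div_nonneg ht.1 hl.le, (div_le_one hl).2 ht.2⟩
  let η : UnitSpeedGeodesic x :=
    { dom := Icc 0 l
      toFun := fun t => if t ∈ Icc (0 : ℝ) l then c (t / l) else x
      ordConnected := ordConnected_Icc
      zero_mem := ⟨le_rfl, hl.le⟩
      nonneg := fun t ht => ht.1
      map_zero := by simp [hl.le, hc.source]
      dist_eq := by
        intro s hs t ht
        rw [if_pos hs, if_pos ht, hc.dist_eq _ (hdiv s hs) _ (hdiv t ht), ← sub_div, abs_div,
          abs_of_pos hl, ← hldef, div_mul_cancel₀ _ hl.ne']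
      outside := fun t ht => if_neg ht }
  have h0 : ∀ t ∈ γ.dom, t = 0 := fun t ht => le_antisymm (hcon t ht) (γ.nonneg t ht)
  have hext : η.Extends γ := by
    refine ⟨fun t ht => ?_, fun t ht => ?_⟩
    · rw [h0 t ht]; exact η.zero_mem
    · rw [h0 t ht, η.map_zero, γ.map_zero]
  have hmem : l ∈ η.dom := ⟨hl.le, le_rfl⟩
  rw [hγ η hext] at hmem
  exact absurd (hcon l hmem) (not_le.2 hl)

end UnitSpeedGeodesic

/-! ### The tangent cone -/

/-- The set `Γ_x` of maximal unit speed geodesics starting at `x`. -/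
def MaximalGeodesic {X : Type u} [MetricSpace X] (x : X) : Type u :=
  {γ : UnitSpeedGeodesic x // γ.IsMaximal}

instance {X : Type u} [MetricSpace X] (x : X) : Nonempty (MaximalGeodesic x) :=
  let ⟨γ, h⟩ := UnitSpeedGeodesic.exists_isMaximal x
  ⟨⟨γ, h⟩⟩

section Cone

variable {X : Type u} [MetricSpace X] {x : X}

/-- The numbers `d(γ(rs), η(rt)) / r`, for `r ∈ (0,1]` such that `γ(rs)` and `η(rt)` are defined. -/
def scaledDists (p q : MaximalGeodesic x × ℝ≥0) : Set ℝ :=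
  {ρ | ∃ r : ℝ, 0 < r ∧ r ≤ 1 ∧ r * p.2 ∈ p.1.1.dom ∧ r * q.2 ∈ q.1.1.dom ∧
    ρ = dist (p.1.1.toFun (r * p.2)) (q.1.1.toFun (r * q.2)) / r}

/-- `d_x((γ,s),(η,t)) = sup_r d(γ(rs), η(rt)) / r`. In a Busemann concave space the quotient is
non-increasing in `r`, so the supremum is the limit for `r → 0`, and does not change if `r` is
restricted further by an upper bound. (If `X` is the single point `x`, the set may be empty; its
supremum is then read as `0`, and the cone is a point.) -/
noncomputable def coneDist (p q : MaximalGeodesic x × ℝ≥0) : ℝ :=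
  sSup (scaledDists p q)

theorem scaledDists_le {p q : MaximalGeodesic x × ℝ≥0} {ρ : ℝ} (h : ρ ∈ scaledDists p q) :
    ρ ≤ p.2 + q.2 := by
  obtain ⟨r, hr, -, hp, hq, rfl⟩ := h
  rw [div_le_iff₀ hr]
  have := dist_triangle_left (p.1.1.toFun (r * p.2)) (q.1.1.toFun (r * q.2)) x
  rw [p.1.1.dist_base hp, q.1.1.dist_base hq] at this
  linarith

theorem bddAbove_scaledDists (p q : MaximalGeodesic x × ℝ≥0) : BddAbove (scaledDists p q) :=
  ⟨p.2 + q.2, fun _ h => scaledDists_le h⟩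

theorem coneDist_nonneg (p q : MaximalGeodesic x × ℝ≥0) : 0 ≤ coneDist p q := by
  refine Real.sSup_nonneg ?_
  rintro _ ⟨r, hr, -, -, -, rfl⟩
  exact div_nonneg dist_nonneg hr.le

theorem coneDist_self (p : MaximalGeodesic x × ℝ≥0) : coneDist p p = 0 := by
  refine le_antisymm (Real.sSup_le ?_ le_rfl) (coneDist_nonneg p p)
  rintro _ ⟨r, -, -, -, -, rfl⟩
  simp

theorem coneDist_comm (p q : MaximalGeodesic x × ℝ≥0) : coneDist p q = coneDist q p := by
  have : ∀ p q : MaximalGeodesic x × ℝ≥0, scaledDists p q ⊆ scaledDists q p := by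
    rintro p q _ ⟨r, h0, h1, hp, hq, rfl⟩
    exact ⟨r, h0, h1, hq, hp, by rw [dist_comm]⟩
  exact congrArg sSup (Subset.antisymm (this p q) (this q p))

theorem isGeodesic_rescale (γ : UnitSpeedGeodesic x) {a : ℝ} (ha : a ∈ γ.dom) :
    IsGeodesic (fun t => γ.toFun (t * a)) x (γ.toFun a) := by
  have h0 := γ.nonneg a ha
  have hmem : ∀ t ∈ Icc (0 : ℝ) 1, t * a ∈ γ.dom := fun t ht =>
    γ.mem_of_le ha (mul_nonneg ht.1 h0) (mul_le_of_le_one_left h0 ht.2)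
  refine ⟨by simp [γ.map_zero], by simp, fun s hs t ht => ?_⟩
  rw [γ.dist_eq _ (hmem s hs) _ (hmem t ht), γ.dist_base ha, ← sub_mul, abs_mul, abs_of_nonneg h0]

/-- The quotient `d(γ(rs), η(rt)) / r` is non-increasing in `r`. -/
theorem scaledDist_antitone [IsBusemannConcave X] (γ η : UnitSpeedGeodesic x) {s t r u : ℝ}
    (hr : 0 < r) (hs : r * s ∈ γ.dom) (ht : r * t ∈ η.dom) (hu : 0 < u) (hu1 : u ≤ 1) :
    dist (γ.toFun (r * s)) (η.toFun (r * t)) / r ≤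
      dist (γ.toFun (u * r * s)) (η.toFun (u * r * t)) / (u * r) := by
  have hc := IsBusemannConcave.concaveOn x _ _ _ _ (isGeodesic_rescale γ hs)
    (isGeodesic_rescale η ht)
  have h := hc.2 (x := 1) (y := 0) (by simp) (by simp) hu.le (sub_nonneg.2 hu1) (by ring)
  simp only [smul_eq_mul, mul_one, mul_zero, add_zero, one_mul, zero_mul, γ.map_zero, η.map_zero,
    dist_self] at h
  rw [div_le_div_iff₀ hr (mul_pos hu hr), mul_assoc u r s, mul_assoc u r t]
  nlinarith

theorem coneDist_triangle [IsBusemannConcave X] (p q w : MaximalGeodesic x × ℝ≥0) :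
    coneDist p w ≤ coneDist p q + coneDist q w := by
  refine Real.sSup_le ?_ (add_nonneg (coneDist_nonneg p q) (coneDist_nonneg q w))
  rintro _ ⟨r, hr, hr1, hp, hw, rfl⟩
  by_cases hX : ∃ y : X, y ≠ x
  · obtain ⟨y, hy⟩ := hX
    obtain ⟨a, ha, ha0⟩ := q.1.2.exists_pos hy
    have hq0 : (0 : ℝ) ≤ q.2 := q.2.2
    have hden : 0 < r * (q.2 : ℝ) + a := by positivity
    obtain ⟨u, hu, hu1, hua⟩ : ∃ u : ℝ, 0 < u ∧ u ≤ 1 ∧ u * r * q.2 ≤ a := by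
      refine ⟨a / (r * q.2 + a), by positivity, ?_, ?_⟩
      · rw [div_le_one hden]
        nlinarith [mul_nonneg hr.le hq0]
      · rw [mul_assoc, div_mul_eq_mul_div, div_le_iff₀ hden]
        nlinarith
    have hur : 0 < u * r := mul_pos hu hr
    have hur1 : u * r ≤ 1 := mul_le_one₀ hu1 hr.le hr1
    have hqm : u * r * q.2 ∈ q.1.1.dom := q.1.1.mem_of_le ha (by positivity) hua
    have hsmall : ∀ z : MaximalGeodesic x × ℝ≥0, r * z.2 ∈ z.1.1.dom →
        u * r * z.2 ∈ z.1.1.dom := fun z hz => by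
      rw [mul_assoc]
      exact z.1.1.mem_of_le hz (by positivity) (mul_le_of_le_one_left (by positivity) hu1)
    refine (scaledDist_antitone p.1.1 w.1.1 hr hp hw hu hu1).trans ?_
    have h1 : dist (p.1.1.toFun (u * r * p.2)) (q.1.1.toFun (u * r * q.2)) / (u * r) ≤
        coneDist p q :=
      le_csSup (bddAbove_scaledDists p q) ⟨u * r, hur, hur1, hsmall p hp, hqm, rfl⟩
    have h2 : dist (q.1.1.toFun (u * r * q.2)) (w.1.1.toFun (u * r * w.2)) / (u * r) ≤
        coneDist q w :=
      le_csSup (bddAbove_scaledDists q w) ⟨u * r, hur, hur1, hqm, hsmall w hw, rfl⟩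
    refine le_trans ?_ (add_le_add h1 h2)
    rw [← add_div]
    exact div_le_div_of_nonneg_right (dist_triangle _ _ _) hur.le
  · push Not at hX
    rw [hX (p.1.1.toFun _), hX (w.1.1.toFun _), dist_self, zero_div]
    exact add_nonneg (coneDist_nonneg p q) (coneDist_nonneg q w)

theorem coneDist_tip (p q : MaximalGeodesic x × ℝ≥0) (hp : p.2 = 0) (hq : q.2 = 0) :
    coneDist p q = 0 := by
  refine le_antisymm (Real.sSup_le ?_ le_rfl) (coneDist_nonneg p q)
  intro ρ hρ
  simpa [hp, hq] using scaledDists_le hρ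

variable (x) in
/-- The identification of all points `(γ, 0)`. -/
def tipSetoid : Setoid (MaximalGeodesic x × ℝ≥0) where
  r p q := p = q ∨ (p.2 = 0 ∧ q.2 = 0)
  iseqv :=
    { refl := fun _ => Or.inl rfl
      symm := by
        rintro p q (rfl | ⟨h, h'⟩)
        · exact Or.inl rfl
        · exact Or.inr ⟨h', h⟩
      trans := by
        rintro p q w (rfl | ⟨h, h'⟩) (rfl | ⟨k, k'⟩)
        · exact Or.inl rfl
        · exact Or.inr ⟨k, k'⟩
        · exact Or.inr ⟨h, h'⟩
        · exact Or.inr ⟨h, k'⟩ }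

variable (x) in
/-- The pre-tangent cone at `x`: the set `Γ_x × [0,∞)` with all points `(γ, 0)` identified. -/
def PreTangentCone : Type u := Quotient (tipSetoid x)

theorem coneDist_congr [IsBusemannConcave X] {p p' q q' : MaximalGeodesic x × ℝ≥0}
    (hp : tipSetoid x p p') (hq : tipSetoid x q q') : coneDist p q = coneDist p' q' := by
  have zero : ∀ {a b : MaximalGeodesic x × ℝ≥0}, tipSetoid x a b → coneDist a b = 0 := by
    rintro a b (rfl | ⟨h, h'⟩)
    · exact coneDist_self a
    · exact coneDist_tip a b h h'
  have hp0 := zero hp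
  have hq0 := zero hq
  have h1 := coneDist_triangle p p' q
  have h2 := coneDist_triangle p' q' q
  have h3 := coneDist_triangle p' p q'
  have h4 := coneDist_triangle p q q'
  rw [coneDist_comm q' q] at h2
  rw [coneDist_comm p' p] at h3
  linarith

/-- The distance `d_x` on the pre-tangent cone. -/
noncomputable instance [IsBusemannConcave X] : PseudoMetricSpace (PreTangentCone x) where
  dist := Quotient.lift₂ coneDist fun _ _ _ _ hp hq => coneDist_congr hp hq
  dist_self := by rintro ⟨p⟩; exact coneDist_self p
  dist_comm := by rintro ⟨p⟩ ⟨q⟩; exact coneDist_comm p q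
  dist_triangle := by rintro ⟨p⟩ ⟨q⟩ ⟨w⟩; exact coneDist_triangle p q w

variable (x) in
/-- The tangent cone `(T_x X, d_x)`: the metric completion of the pre-tangent cone. -/
abbrev TangentCone [IsBusemannConcave X] : Type u :=
  UniformSpace.Completion (PreTangentCone x)

variable (x) in
/-- The class of the points `(γ, 0)` in the pre-tangent cone. -/
noncomputable def PreTangentCone.tip : PreTangentCone x :=
  Quotient.mk (tipSetoid x) (Classical.arbitrary (MaximalGeodesic x), 0)

variable (x) in
/-- The base point of the tangent cone. -/
noncomputable def TangentCone.tip [IsBusemannConcave X] : TangentCone x :=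
  ((PreTangentCone.tip x : PreTangentCone x) : UniformSpace.Completion (PreTangentCone x))

end Cone

/-! ### Pointed Gromov–Hausdorff convergence and blow-ups -/

/-- A metric coupling of two pointed metric spaces: isometric embeddings into a common metric
space that send both base points to the same point. -/
structure PointedCoupling {X : Type u} {Y : Type v} [MetricSpace X] [MetricSpace Y]
    (x : X) (y : Y) where
  Z : Type (max u v)
  [metric : MetricSpace Z]
  left : X → Z
  right : Y → Z
  isometry_left : Isometry left
  isometry_right : Isometry right
  base_eq : left x = right y

attribute [instance] PointedCoupling.metric

/-- The Gromov–Hausdorff distance of `(X,x)` and `(Y,y)`: the infimum, over all metric couplings of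
the pointed spaces, of the Hausdorff distance of the images. -/
noncomputable def pointedGHDist {X : Type u} {Y : Type v} [MetricSpace X] [MetricSpace Y]
    (x : X) (y : Y) : ℝ≥0∞ :=
  ⨅ c : PointedCoupling x y, Metric.hausdorffEDist (range c.left) (range c.right)

/-- Pointed Gromov–Hausdorff convergence of `(X i, x i)` to `(Y, y)` along the filter `l`: for each
`r > 0` the Gromov–Hausdorff distance of the pointed balls of radius `r` tends to `0`. -/
def PointedGHTendsto {ι : Type*} (X : ι → Type u) [∀ i, MetricSpace (X i)] (x : ∀ i, X i)
    (l : Filter ι) (Y : Type v) [MetricSpace Y] (y : Y) : Prop :=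
  ∀ (r : ℝ) (hr : 0 < r), Tendsto
    (fun i => pointedGHDist
      (⟨x i, Metric.mem_ball_self hr⟩ : Metric.ball (x i) r)
      (⟨y, Metric.mem_ball_self hr⟩ : Metric.ball y r)) l (𝓝 0)

/-- A copy of the set `X`, to be equipped with the metric `d / lam`. -/
@[ext]
structure Blowup (X : Type u) (lam : Ioi (0 : ℝ)) : Type u where
  val : X

/-- The rescaled metric `d / lam`. -/
noncomputable instance (X : Type u) [MetricSpace X] (lam : Ioi (0 : ℝ)) :
    MetricSpace (Blowup X lam) where
  dist p q := dist p.val q.val / (lam : ℝ)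
  dist_self p := by simp
  dist_comm p q := by simp only [dist_comm]
  dist_triangle p q w := by
    rw [← add_div]
    exact div_le_div_of_nonneg_right (dist_triangle _ _ _) (le_of_lt lam.2)
  eq_of_dist_eq_zero {p q} h := by
    rcases div_eq_zero_iff.1 h with h0 | h0
    · exact Blowup.ext (dist_eq_zero.1 h0)
    · exact absurd h0 (ne_of_gt lam.2)

end BusemannTangent

/-! Concavity for two geodesics from `x` makes `d(γ(rs), η(rt)) / r` non-increasing in `r`, so the
supremum defining `coneDist` is the limit as `r → 0`. Hence the exponential map `(γ, s) ↦ γ(lam s)`,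
into `X` with metric `d / lam`, is non-expanding for `lam ≤ 1` wherever it is defined
(`dist_expMap_le_coneDist`), and on each fixed pair it is almost distance preserving for small `lam`
(`eventually_lt_dist_expMap`). It is also onto, since every point lies on a maximal geodesic
(`exists_maximalGeodesic_through`).

Doubling gives compactness: the exponential map at a small scale carries a finite separated set in a
ball of the cone to a separated set in a small ball of `X`, whose cardinality is bounded
independently of the scale (`exists_card_le_of_separated`). So balls of the cone have finite nets,
and the completion is proper. On a finite net one scale serves all pairs; with surjectivity and the
non-expanding property this gives correspondences of small distortion between balls
(`ballsClose_blowup_of_net`).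

Gromov–Hausdorff convergence is handled through correspondences (`pointedGHTendsto_iff`), which
compose. Two limits of the same blow-ups therefore have balls related with arbitrarily small
distortion, and an ultrafilter limit of these relations is an isometry
(`exists_isometryEquiv_of_ballsClose`). -/

namespace BusemannTangent

/-! ### Gluing pointed metric spaces along a correspondence -/

section Glue

variable {A : Type u} {B : Type v} [MetricSpace A] [MetricSpace B] {ι : Type*}

/-- The distance of `p` to `q` through bridges of length `e i` between `Φ i` and `Ψ i`. -/
noncomputable def bridgeDist (Φ : ι → A) (Ψ : ι → B) (e : ι → ℝ) (p : A) (q : B) : ℝ :=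
  ⨅ i, (dist p (Φ i) + e i + dist (Ψ i) q)

variable {Φ : ι → A} {Ψ : ι → B} {e : ι → ℝ}

theorem bridgeDist_le (he : ∀ i, 0 ≤ e i) (p : A) (q : B) (i : ι) :
    bridgeDist Φ Ψ e p q ≤ dist p (Φ i) + e i + dist (Ψ i) q :=
  ciInf_le ⟨0, by rintro _ ⟨j, rfl⟩; have := he j; positivity⟩ i

theorem exists_lt_bridgeDist_add [Nonempty ι] (p : A) (q : B) {δ : ℝ} (hδ : 0 < δ) :
    ∃ i, dist p (Φ i) + e i + dist (Ψ i) q < bridgeDist Φ Ψ e p q + δ :=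
  exists_lt_of_ciInf_lt (lt_add_of_pos_right _ hδ)

theorem bridgeDist_triangle_left [Nonempty ι] (he : ∀ i, 0 ≤ e i) (p p' : A) (q : B) :
    bridgeDist Φ Ψ e p q ≤ dist p p' + bridgeDist Φ Ψ e p' q := by
  refine le_of_forall_pos_le_add fun δ hδ => ?_
  obtain ⟨i, hi⟩ := exists_lt_bridgeDist_add (Φ := Φ) (Ψ := Ψ) (e := e) p' q hδ
  have := bridgeDist_le (Φ := Φ) (Ψ := Ψ) he p q i
  have := dist_triangle p p' (Φ i)
  linarith

theorem bridgeDist_triangle_right [Nonempty ι] (he : ∀ i, 0 ≤ e i) (p : A) (q q' : B) :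
    bridgeDist Φ Ψ e p q ≤ bridgeDist Φ Ψ e p q' + dist q' q := by
  refine le_of_forall_pos_le_add fun δ hδ => ?_
  obtain ⟨i, hi⟩ := exists_lt_bridgeDist_add (Φ := Φ) (Ψ := Ψ) (e := e) p q' hδ
  have := bridgeDist_le (Φ := Φ) (Ψ := Ψ) he p q i
  have := dist_triangle (Ψ i) q' q
  linarith

/-- A detour through `B` over the bridges `i` and `j` costs at least `dist (Ψ i) (Ψ j) + e i + e j`,
which by `H` is at least `dist (Φ i) (Φ j)`. So the bridges create no shortcuts inside `A`. -/
theorem dist_le_bridgeDist_add_left [Nonempty ι]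
    (H : ∀ i j, |dist (Φ i) (Φ j) - dist (Ψ i) (Ψ j)| ≤ e i + e j) (p p' : A) (q : B) :
    dist p p' ≤ bridgeDist Φ Ψ e p q + bridgeDist Φ Ψ e p' q := by
  refine le_of_forall_pos_le_add fun δ hδ => ?_
  obtain ⟨i, hi⟩ := exists_lt_bridgeDist_add (Φ := Φ) (Ψ := Ψ) (e := e) p q (half_pos hδ)
  obtain ⟨j, hj⟩ := exists_lt_bridgeDist_add (Φ := Φ) (Ψ := Ψ) (e := e) p' q (half_pos hδ)
  have := (abs_le.1 (H i j)).2
  have := dist_triangle4 p (Φ i) (Φ j) p'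
  have := dist_triangle_right (Ψ i) (Ψ j) q
  rw [dist_comm (Φ j) p'] at *
  linarith

theorem dist_le_bridgeDist_add_right [Nonempty ι]
    (H : ∀ i j, |dist (Φ i) (Φ j) - dist (Ψ i) (Ψ j)| ≤ e i + e j) (p : A) (q q' : B) :
    dist q q' ≤ bridgeDist Φ Ψ e p q + bridgeDist Φ Ψ e p q' := by
  refine le_of_forall_pos_le_add fun δ hδ => ?_
  obtain ⟨i, hi⟩ := exists_lt_bridgeDist_add (Φ := Φ) (Ψ := Ψ) (e := e) p q (half_pos hδ)
  obtain ⟨j, hj⟩ := exists_lt_bridgeDist_add (Φ := Φ) (Ψ := Ψ) (e := e) p q' (half_pos hδ)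
  have := (abs_le.1 (H i j)).1
  have := dist_triangle4 q (Ψ i) (Ψ j) q'
  have := dist_triangle_left (Φ i) (Φ j) p
  rw [dist_comm q (Ψ i)] at *
  linarith

/-- A copy of the disjoint union, without topology. -/
def BridgeSpace (A : Type u) (B : Type v) : Type (max u v) := A ⊕ B

/-- The pseudometric on the disjoint union obtained by joining `Φ i` and `Ψ i` by
bridges of length `e i`. -/
noncomputable abbrev bridgePseudoMetric [Nonempty ι] (Φ : ι → A) (Ψ : ι → B) (e : ι → ℝ)
    (he : ∀ i, 0 ≤ e i)
    (H : ∀ i j, |dist (Φ i) (Φ j) - dist (Ψ i) (Ψ j)| ≤ e i + e j) :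
    PseudoMetricSpace (BridgeSpace A B) where
  dist (z w : A ⊕ B) := match z, w with
    | .inl p, .inl p' => dist p p'
    | .inr q, .inr q' => dist q q'
    | .inl p, .inr q => bridgeDist Φ Ψ e p q
    | .inr q, .inl p => bridgeDist Φ Ψ e p q
  dist_self := by rintro (p | q) <;> exact dist_self _
  dist_comm := by
    rintro (p | q) (p' | q')
    exacts [dist_comm _ _, rfl, rfl, dist_comm _ _]
  dist_triangle := by
    rintro (p | q) (p' | q') (p₂ | q₂)
    · exact dist_triangle p p' p₂
    · exact bridgeDist_triangle_left he p p' q₂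
    · exact dist_le_bridgeDist_add_left H p p₂ q'
    · exact bridgeDist_triangle_right he p q₂ q'
    · have := bridgeDist_triangle_left (Φ := Φ) (Ψ := Ψ) he p₂ p' q
      rw [dist_comm, add_comm] at this
      exact this
    · exact dist_le_bridgeDist_add_right H p' q q₂
    · have := bridgeDist_triangle_right (Φ := Φ) (Ψ := Ψ) he p₂ q q'
      rw [dist_comm, add_comm] at this
      exact this
    · exact dist_triangle q _ q₂

/-- A correspondence with distortion at most `ε` that relates the base points gives a coupling in
which related points have distance at most `ε`. -/
theorem exists_pointedCoupling (a : A) (b : B) (R : A → B → Prop) {ε : ℝ} (hε : 0 ≤ ε)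
    (base : R a b) (distortion : ∀ p q p' q', R p q → R p' q' → |dist p p' - dist q q'| ≤ ε) :
    ∃ c : PointedCoupling a b, ∀ p q, R p q → dist (c.left p) (c.right q) ≤ ε := by
  -- The index `none` is a bridge of length `0` between the base points, which forces them to
  -- coincide in the quotient. The other bridges need length `ε` rather than `ε / 2`, because a pair
  -- with `none` must absorb the whole distortion.
  let ι := Option {z : A × B // R z.1 z.2}
  let Φ : ι → A := fun i => i.elim a fun z => z.1.1
  let Ψ : ι → B := fun i => i.elim b fun z => z.1.2
  let e : ι → ℝ := fun i => i.elim 0 fun _ => ε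
  have he : ∀ i, 0 ≤ e i := by
    rintro (_ | z)
    exacts [le_rfl, hε]
  have H : ∀ i j, |dist (Φ i) (Φ j) - dist (Ψ i) (Ψ j)| ≤ e i + e j := by
    rintro (_ | ⟨⟨p, q⟩, h⟩) (_ | ⟨⟨p', q'⟩, h'⟩)
    · simp [Φ, Ψ, e]
    · simpa [Φ, Ψ, e] using distortion _ _ _ _ base h'
    · simpa [Φ, Ψ, e] using distortion _ _ _ _ h base
    · refine (distortion _ _ _ _ h h').trans ?_
      simpa [e] using hε
  let _ := bridgePseudoMetric Φ Ψ e he H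
  have cross (p : A) (q : B) (i : ι) : dist (α := BridgeSpace A B) (Sum.inl p) (Sum.inr q) ≤
      dist p (Φ i) + e i + dist (Ψ i) q := bridgeDist_le he p q i
  refine ⟨{ Z := SeparationQuotient (BridgeSpace A B)
            left := fun p => SeparationQuotient.mk (Sum.inl p : A ⊕ B)
            right := fun q => SeparationQuotient.mk (Sum.inr q : A ⊕ B)
            isometry_left := Isometry.of_dist_eq fun p p' => SeparationQuotient.dist_mk _ _
            isometry_right := Isometry.of_dist_eq fun q q' => SeparationQuotient.dist_mk _ _
            base_eq := ?_ }, fun p q h => ?_⟩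
  · refine dist_le_zero.1 ((SeparationQuotient.dist_mk _ _).trans_le ((cross a b none).trans ?_))
    simp [Φ, Ψ, e]
  · refine (SeparationQuotient.dist_mk _ _).trans_le ((cross p q (some ⟨(p, q), h⟩)).trans ?_)
    simp [Φ, Ψ, e]

end Glue

/-! ### Correspondences between balls -/

section Correspondence

variable {A : Type*} {B : Type*} {C : Type*} [MetricSpace A] [MetricSpace B] [MetricSpace C]

/-- `R` relates each point of `B_r(a)` to a point of `B_r(b)` and conversely, it relates `a` to `b`,
and the distances of related pairs differ by at most `ε`. -/
structure IsBallCorrespondence (a : A) (b : B) (r ε : ℝ) (R : A → B → Prop) : Prop where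
  base : R a b
  left : ∀ p ∈ Metric.ball a r, ∃ q ∈ Metric.ball b r, R p q
  right : ∀ q ∈ Metric.ball b r, ∃ p ∈ Metric.ball a r, R p q
  distortion : ∀ p q p₁ q₁, R p q → R p₁ q₁ → |dist p p₁ - dist q q₁| ≤ ε

/-- The balls `B_r(a)` and `B_r(b)` admit a pointed correspondence of distortion at most `ε`. -/
def BallsClose (a : A) (b : B) (r ε : ℝ) : Prop := ∃ R, IsBallCorrespondence a b r ε R

theorem BallsClose.symm {a : A} {b : B} {r ε : ℝ} (h : BallsClose a b r ε) :
    BallsClose b a r ε := by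
  obtain ⟨R, h⟩ := h
  refine ⟨fun q p => R p q, h.base, h.right, h.left, fun q p q' p' h1 h2 => ?_⟩
  rw [abs_sub_comm]
  exact h.distortion _ _ _ _ h1 h2

/-- Partners of points of a ball can be chosen in the ball of the same radius, so the relations
compose without loss of radius and the distortions add. -/
theorem BallsClose.trans {a : A} {b : B} {c : C} {r ε δ : ℝ} (h : BallsClose a b r ε)
    (h' : BallsClose b c r δ) : BallsClose a c r (ε + δ) := by
  obtain ⟨R, h⟩ := h
  obtain ⟨S, h'⟩ := h'
  refine ⟨fun p w => ∃ q, R p q ∧ S q w, ⟨b, h.base, h'.base⟩, fun p hp => ?_, fun w hw => ?_, ?_⟩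
  · obtain ⟨q, hq, hpq⟩ := h.left p hp
    obtain ⟨w, hw, hqw⟩ := h'.left q hq
    exact ⟨w, hw, q, hpq, hqw⟩
  · obtain ⟨q, hq, hqw⟩ := h'.right w hw
    obtain ⟨p, hp, hpq⟩ := h.right q hq
    exact ⟨p, hp, q, hpq, hqw⟩
  · rintro p w p' w' ⟨q, h1, h2⟩ ⟨q', h1', h2'⟩
    exact (abs_sub_le _ (dist q q') _).trans
      (add_le_add (h.distortion _ _ _ _ h1 h1') (h'.distortion _ _ _ _ h2 h2'))

theorem BallsClose.pointedGHDist_le {a : A} {b : B} {r ε : ℝ} (hr : 0 < r) (hε : 0 ≤ ε)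
    (h : BallsClose a b r ε) :
    pointedGHDist (⟨a, Metric.mem_ball_self hr⟩ : Metric.ball a r)
      (⟨b, Metric.mem_ball_self hr⟩ : Metric.ball b r) ≤ ENNReal.ofReal ε := by
  obtain ⟨R, h⟩ := h
  obtain ⟨c, hc⟩ := exists_pointedCoupling (⟨a, Metric.mem_ball_self hr⟩ : Metric.ball a r)
    (⟨b, Metric.mem_ball_self hr⟩ : Metric.ball b r) (fun p q => R p q) hε h.base
    fun p q p' q' h1 h2 => h.distortion _ _ _ _ h1 h2
  refine (iInf_le _ c).trans (Metric.hausdorffEDist_le_of_mem_edist ?_ ?_)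
  · rintro _ ⟨p, rfl⟩
    obtain ⟨q, hq, hpq⟩ := h.left p p.2
    refine ⟨_, ⟨⟨q, hq⟩, rfl⟩, ?_⟩
    rw [edist_dist]
    exact ENNReal.ofReal_le_ofReal (hc p ⟨q, hq⟩ hpq)
  · rintro _ ⟨q, rfl⟩
    obtain ⟨p, hp, hpq⟩ := h.right q q.2
    refine ⟨_, ⟨⟨p, hp⟩, rfl⟩, ?_⟩
    rw [edist_comm, edist_dist]
    exact ENNReal.ofReal_le_ofReal (hc ⟨p, hp⟩ q hpq)

/-- Points are related when a near-optimal coupling puts them within `ε`; the factor `2` comes from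
moving both endpoints of a segment. -/
theorem ballsClose_of_pointedGHDist_lt {a : A} {b : B} {r ε : ℝ} (hr : 0 < r) (hε : 0 < ε)
    (h : pointedGHDist (⟨a, Metric.mem_ball_self hr⟩ : Metric.ball a r)
      (⟨b, Metric.mem_ball_self hr⟩ : Metric.ball b r) < ENNReal.ofReal ε) :
    BallsClose a b r (2 * ε) := by
  obtain ⟨c, hc⟩ := iInf_lt_iff.1 h
  refine ⟨fun p q => ∃ hp hq, dist (c.left ⟨p, hp⟩) (c.right ⟨q, hq⟩) < ε,
    ⟨Metric.mem_ball_self hr, Metric.mem_ball_self hr, ?_⟩, fun p hp => ?_, fun q hq => ?_, ?_⟩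
  · rwa [c.base_eq, dist_self]
  · obtain ⟨_, ⟨q, rfl⟩, hq⟩ := Metric.exists_edist_lt_of_hausdorffEDist_lt
      (mem_range_self (⟨p, hp⟩ : Metric.ball a r)) hc
    rw [edist_dist, ENNReal.ofReal_lt_ofReal_iff hε] at hq
    exact ⟨q, q.2, hp, q.2, hq⟩
  · rw [Metric.hausdorffEDist_comm] at hc
    obtain ⟨_, ⟨p, rfl⟩, hp⟩ := Metric.exists_edist_lt_of_hausdorffEDist_lt
      (mem_range_self (⟨q, hq⟩ : Metric.ball b r)) hc
    rw [edist_comm, edist_dist, ENNReal.ofReal_lt_ofReal_iff hε] at hp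
    exact ⟨p, p.2, p.2, hq, hp⟩
  · rintro p q p' q' ⟨hp, hq, h1⟩ ⟨hp', hq', h2⟩
    have e1 : dist (c.left ⟨p, hp⟩) (c.left ⟨p', hp'⟩) = dist p p' := c.isometry_left.dist_eq _ _
    have e2 : dist (c.right ⟨q, hq⟩) (c.right ⟨q', hq'⟩) = dist q q' :=
      c.isometry_right.dist_eq _ _
    have h3 := dist_triangle4 (c.left ⟨p, hp⟩) (c.right ⟨q, hq⟩) (c.right ⟨q', hq'⟩)
      (c.left ⟨p', hp'⟩)
    have h4 := dist_triangle4 (c.right ⟨q, hq⟩) (c.left ⟨p, hp⟩) (c.left ⟨p', hp'⟩)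
      (c.right ⟨q', hq'⟩)
    rw [dist_comm (c.right ⟨q', hq'⟩) (c.left ⟨p', hp'⟩)] at h3
    rw [dist_comm (c.right ⟨q, hq⟩) (c.left ⟨p, hp⟩)] at h4
    rw [abs_le]
    constructor <;> linarith

theorem pointedGHTendsto_iff {ι : Type*} {Z : ι → Type u} [∀ i, MetricSpace (Z i)] {z : ∀ i, Z i}
    {l : Filter ι} {Y : Type v} [MetricSpace Y] {y : Y} :
    PointedGHTendsto Z z l Y y ↔
      ∀ r : ℝ, 0 < r → ∀ ε : ℝ, 0 < ε → ∀ᶠ i in l, BallsClose (z i) y r ε := by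
  refine ⟨fun h r hr ε hε => ?_, fun h r hr => ?_⟩
  · have h0 : (0 : ℝ≥0∞) < ENNReal.ofReal (ε / 2) := ENNReal.ofReal_pos.2 (half_pos hε)
    filter_upwards [(h r hr).eventually_lt_const h0] with i hi
    have := ballsClose_of_pointedGHDist_lt hr (half_pos hε) hi
    rwa [mul_div_cancel₀ _ two_ne_zero] at this
  · rw [ENNReal.tendsto_nhds_zero]
    intro ε hε
    -- `ε` may be infinite here, so a finite positive `δ` below it is used instead.
    obtain ⟨δ, -, hδ0, hδ⟩ := ENNReal.lt_iff_exists_real_btwn.1 hε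
    filter_upwards [h r hr δ (ENNReal.ofReal_pos.1 hδ0)] with i hi
    exact (hi.pointedGHDist_le hr (ENNReal.ofReal_pos.1 hδ0).le).trans hδ.le

/-! ### Uniqueness of proper limits -/

theorem properSpace_of_totallyBounded_ball [CompleteSpace B] (b : B)
    (tb : ∀ r : ℝ, 0 < r → TotallyBounded (Metric.ball b r)) : ProperSpace B := by
  refine ProperSpace.of_seq_closedBall (β := ℕ) (l := atTop) (x := b) (r := fun n => (n : ℝ))
    tendsto_natCast_atTop_atTop (Eventually.of_forall fun n => ?_)
  refine TotallyBounded.isCompact_of_isClosed ((tb (n + 1) (by positivity)).subset ?_)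
    Metric.isClosed_closedBall
  exact Metric.closedBall_subset_ball (by linarith)

/-- A correspondence transports finite nets: two points whose partners lie within `ε / 4` of the
same net point are closer than `ε / 4 + ε / 4 + ε / 2`. -/
theorem properSpace_of_ballsClose [ProperSpace A] [CompleteSpace B] {a : A} {b : B}
    (h : ∀ r : ℝ, 0 < r → ∀ ε : ℝ, 0 < ε → BallsClose a b r ε) : ProperSpace B := by
  refine properSpace_of_totallyBounded_ball b fun r hr => ?_
  rw [Metric.totallyBounded_iff]
  intro ε hε
  obtain ⟨R, hR⟩ := h r hr (ε / 2) (half_pos hε)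
  have hA : TotallyBounded (Metric.ball a r) :=
    (isCompact_closedBall a r).totallyBounded.subset Metric.ball_subset_closedBall
  obtain ⟨t, ht, hcov⟩ := Metric.totallyBounded_iff.1 hA (ε / 4) (by positivity)
  -- For each net point, one partner of some nearby point; the default `b` is never used in the
  -- estimate.
  let f : A → B := fun z =>
    open Classical in if h : ∃ q p, dist p z < ε / 4 ∧ R p q then h.choose else b
  refine ⟨image f t, ht.image f, fun q hq => ?_⟩
  obtain ⟨p, hp, hpq⟩ := hR.right q hq
  obtain ⟨z, hz, hpz⟩ := mem_iUnion₂.1 (hcov hp)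
  rw [Metric.mem_ball] at hpz
  have hex : ∃ q p, dist p z < ε / 4 ∧ R p q := ⟨q, p, hpz, hpq⟩
  obtain ⟨p', hp', hpq'⟩ := hex.choose_spec
  have hfz : f z = hex.choose := dif_pos hex
  refine mem_iUnion₂.2 ⟨f z, mem_image_of_mem f hz, ?_⟩
  rw [Metric.mem_ball, hfz]
  have h1 := (abs_le.1 (hR.distortion _ _ _ _ hpq hpq')).1
  have h2 := dist_triangle_right p p' z
  linarith

theorem exists_tendsto_of_eventually_dist_le {ι : Type*} [ProperSpace A] (U : Ultrafilter ι) (c : A)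
    (g : ι → A) (t : ℝ) (hg : ∀ᶠ n in U, dist (g n) c ≤ t) : ∃ w, Tendsto g U (𝓝 w) := by
  obtain ⟨w, -, hw⟩ := (isCompact_closedBall c t).ultrafilter_le_nhds (U.map g)
    (le_principal_iff.2 hg)
  exact ⟨w, hw⟩

/-- Along an ultrafilter the partners of every point converge simultaneously by properness, so no
diagonal choice of subsequences is needed. As the distortion tends to `0`, the limit map is exactly
isometric. -/
theorem exists_isometryEquiv_of_ballsClose [ProperSpace A] [ProperSpace B] {a : A} {b : B}
    (h : ∀ r : ℝ, 0 < r → ∀ ε : ℝ, 0 < ε → BallsClose a b r ε) : ∃ e : A ≃ᵢ B, e a = b := by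
  have hpos (n : ℕ) : (0 : ℝ) < n + 1 := by positivity
  choose R hR using fun n : ℕ => h (n + 1) (hpos n) (1 / (n + 1)) (one_div_pos.2 (hpos n))
  let U : Ultrafilter ℕ := hyperfilter ℕ
  have hU : (U : Filter ℕ) ≤ atTop := Nat.hyperfilter_le_atTop
  have hε : Tendsto (fun n : ℕ => 1 / ((n : ℝ) + 1)) U (𝓝 0) :=
    tendsto_one_div_add_atTop_nhds_zero_nat.mono_left hU
  have hε1 (n : ℕ) : 1 / ((n : ℝ) + 1) ≤ 1 := by
    rw [div_le_one (hpos n)]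
    have : (0 : ℝ) ≤ n := n.cast_nonneg
    linarith
  have hlarge (t : ℝ) : ∀ᶠ n : ℕ in U, t < (n : ℝ) + 1 := by
    refine hU ((tendsto_natCast_atTop_atTop.eventually_gt_atTop t).mono fun n hn => ?_)
    linarith
  have hrel (p : A) : ∃ g : ℕ → B, ∃ q, Tendsto g U (𝓝 q) ∧ ∀ᶠ n in U, R n p (g n) := by
    -- The ball contains `p` for all large `n`, so the default values chosen at the remaining `n` do
    -- not affect the limit.
    have h1 (n : ℕ) : ∃ q, p ∈ Metric.ball a (n + 1) → R n p q := by
      by_cases hp : p ∈ Metric.ball a (n + 1)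
      · obtain ⟨q, -, hq⟩ := (hR n).left p hp
        exact ⟨q, fun _ => hq⟩
      · exact ⟨b, fun h => absurd h hp⟩
    choose g hg using h1
    have h2 : ∀ᶠ n in U, R n p (g n) := (hlarge (dist p a)).mono fun n hn => hg n hn
    obtain ⟨q, hq⟩ := exists_tendsto_of_eventually_dist_le U b g (dist p a + 1)
      (h2.mono fun n hn => by
      have := (abs_le.1 ((hR n).distortion _ _ _ _ hn (hR n).base)).1
      linarith [hε1 n])
    exact ⟨g, q, hq, h2⟩
  choose g f hf hg using hrel
  -- Constant `p'` gives the isometry, constant `q'` gives surjectivity, and both constant give the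
  -- base point.
  have key (p : A) (p' : ℕ → A) (q' : ℕ → B) (w : A) (z : B) (hp' : Tendsto p' U (𝓝 w))
      (hq' : Tendsto q' U (𝓝 z)) (hrel : ∀ᶠ n in U, R n (p' n) (q' n)) :
      dist (f p) z = dist p w := by
    have h1 : Tendsto (fun n => |dist p (p' n) - dist (g p n) (q' n)|) U
        (𝓝 |dist p w - dist (f p) z|) :=
      ((tendsto_const_nhds.dist hp').sub ((hf p).dist hq')).abs
    have h2 := le_of_tendsto_of_tendsto h1 hε (by
      filter_upwards [hg p, hrel] with n h3 h4 using (hR n).distortion _ _ _ _ h3 h4)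
    have := abs_nonpos_iff.1 h2
    linarith
  have hiso : Isometry f :=
    Isometry.of_dist_eq fun p p' => key p _ _ p' (f p') tendsto_const_nhds (hf p') (hg p')
  have hsurj : Function.Surjective f := by
    intro q
    have h1 (n : ℕ) : ∃ p, q ∈ Metric.ball b (n + 1) → R n p q := by
      by_cases hq : q ∈ Metric.ball b (n + 1)
      · obtain ⟨p, -, hp⟩ := (hR n).right q hq
        exact ⟨p, fun _ => hp⟩
      · exact ⟨a, fun h => absurd h hq⟩
    choose p hp using h1
    have h2 : ∀ᶠ n in U, R n (p n) q := (hlarge (dist q b)).mono fun n hn => hp n hn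
    obtain ⟨w, hw⟩ := exists_tendsto_of_eventually_dist_le U a p (dist q b + 1)
      (h2.mono fun n hn => by
      have := (abs_le.1 ((hR n).distortion _ _ _ _ hn (hR n).base)).2
      linarith [hε1 n])
    refine ⟨w, dist_eq_zero.1 ?_⟩
    rw [key w p _ w q hw tendsto_const_nhds h2, dist_self]
  refine ⟨⟨Equiv.ofBijective f ⟨hiso.injective, hsurj⟩, hiso⟩, dist_eq_zero.1 ?_⟩
  exact (key a (fun _ => a) (fun _ => b) a b tendsto_const_nhds tendsto_const_nhds
    (Eventually.of_forall fun n => (hR n).base)).trans (dist_self a)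

end Correspondence

/-! ### Extension to maximal geodesics -/

namespace UnitSpeedGeodesic

variable {X : Type u} [MetricSpace X] {x : X}

theorem Extends.refl (γ : UnitSpeedGeodesic x) : γ.Extends γ := ⟨Subset.rfl, fun _ _ => rfl⟩

theorem Extends.trans {γ η ζ : UnitSpeedGeodesic x} (h : η.Extends γ) (h' : ζ.Extends η) :
    ζ.Extends γ :=
  ⟨h.1.trans h'.1, fun _ ht => (h'.2 (h.1 ht)).trans (h.2 ht)⟩

/-- A nonempty family of geodesics that extend each other has a common extension. -/
theorem exists_extends_of_comparable {c : Set (UnitSpeedGeodesic x)} (hne : c.Nonempty)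
    (hcomp : ∀ γ ∈ c, ∀ η ∈ c, γ.Extends η ∨ η.Extends γ) :
    ∃ ζ : UnitSpeedGeodesic x, ∀ γ ∈ c, ζ.Extends γ := by
  classical
  let f : ℝ → X := fun t => if h : ∃ γ ∈ c, t ∈ γ.dom then h.choose.toFun t else x
  have hf : ∀ γ ∈ c, ∀ t ∈ γ.dom, f t = γ.toFun t := by
    intro γ hγ t ht
    have h : ∃ γ ∈ c, t ∈ γ.dom := ⟨γ, hγ, ht⟩
    simp only [f, dif_pos h]
    rcases hcomp _ h.choose_spec.1 γ hγ with h' | h'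
    · exact h'.2 ht
    · exact (h'.2 h.choose_spec.2).symm
  obtain ⟨ξ, hξ⟩ := hne
  refine ⟨⟨{t | ∃ γ ∈ c, t ∈ γ.dom}, f, ⟨?_⟩, ⟨ξ, hξ, ξ.zero_mem⟩, ?_, ?_, ?_, ?_⟩,
    fun γ hγ => ⟨fun t ht => ⟨γ, hγ, ht⟩, fun t ht => hf γ hγ t ht⟩⟩
  · rintro s ⟨η, -, hs⟩ t ⟨γ, hγ, ht⟩ r hr
    exact ⟨γ, hγ, γ.mem_of_le ht ((η.nonneg s hs).trans hr.1) hr.2⟩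
  · rintro t ⟨γ, -, h⟩
    exact γ.nonneg t h
  · rw [hf ξ hξ 0 ξ.zero_mem, ξ.map_zero]
  · rintro s ⟨γ, hγ, hs⟩ t ⟨η, hη, ht⟩
    obtain ⟨ζ, hζ, h1, h2⟩ : ∃ ζ ∈ c, s ∈ ζ.dom ∧ t ∈ ζ.dom := by
      rcases hcomp γ hγ η hη with h | h
      · exact ⟨γ, hγ, hs, h.1 ht⟩
      · exact ⟨η, hη, h.1 hs, ht⟩
    rw [hf ζ hζ s h1, hf ζ hζ t h2, ζ.dist_eq s h1 t h2]
  · intro t ht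
    exact dif_neg ht

/-- Zorn's lemma on the extensions of `γ₀`. Only nonempty chains need an upper bound, and a common
extension of such a chain extends `γ₀` through any member. -/
theorem exists_isMaximal_extends (γ₀ : UnitSpeedGeodesic x) :
    ∃ γ : UnitSpeedGeodesic x, γ.IsMaximal ∧ γ.Extends γ₀ := by
  let α := {γ : UnitSpeedGeodesic x // γ.Extends γ₀}
  have : Nonempty α := ⟨⟨γ₀, Extends.refl γ₀⟩⟩
  obtain ⟨m, hm⟩ : ∃ m : α, ∀ a : α, a.1.Extends m.1 → m.1.Extends a.1 := by
    refine exists_maximal_of_nonempty_chains_bounded (r := fun γ η : α => η.1.Extends γ.1) ?_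
      fun h h' => h.trans h'
    rintro c hc ⟨ξ, hξ⟩
    obtain ⟨ζ, hζ⟩ := exists_extends_of_comparable (c := image Subtype.val c) ⟨ξ.1, ξ, hξ, rfl⟩ (by
      rintro _ ⟨γ, hγ, rfl⟩ _ ⟨η, hη, rfl⟩
      by_cases h : γ = η
      · subst h; exact Or.inl (Extends.refl _)
      · exact (hc hγ hη h).symm)
    exact ⟨⟨ζ, ξ.2.trans (hζ _ ⟨ξ, hξ, rfl⟩)⟩, fun a ha => hζ _ ⟨a, ha, rfl⟩⟩
  exact ⟨m.1, fun η h => h.antisymm (hm ⟨η, m.2.trans h⟩ h), m.2⟩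

end UnitSpeedGeodesic

section Cone

variable {X : Type u} [MetricSpace X] {x : X}

/-- Every point lies on a maximal geodesic from `x`. -/
theorem exists_maximalGeodesic_through [IsBusemannConcave X] (x y : X) :
    ∃ γ : MaximalGeodesic x, dist x y ∈ γ.1.dom ∧ γ.1.toFun (dist x y) = y := by
  classical
  rcases eq_or_ne x y with rfl | hxy
  · let γ := Classical.arbitrary (MaximalGeodesic x)
    refine ⟨γ, ?_, ?_⟩ <;> rw [dist_self]
    exacts [γ.1.zero_mem, γ.1.map_zero]
  obtain ⟨c, hc⟩ := IsBusemannConcave.exists_geodesic x y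
  have hl : 0 < dist x y := dist_pos.2 hxy
  have hdiv : ∀ t ∈ Icc (0 : ℝ) (dist x y), t / dist x y ∈ Icc (0 : ℝ) 1 := fun t ht =>
    ⟨div_nonneg ht.1 hl.le, (div_le_one hl).2 ht.2⟩
  let η : UnitSpeedGeodesic x :=
    { dom := Icc 0 (dist x y)
      toFun := fun t => if t ∈ Icc (0 : ℝ) (dist x y) then c (t / dist x y) else x
      ordConnected := ordConnected_Icc
      zero_mem := ⟨le_rfl, hl.le⟩
      nonneg := fun t ht => ht.1
      map_zero := by simp [hc.source]
      dist_eq := by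
        intro s hs t ht
        rw [if_pos hs, if_pos ht, hc.dist_eq _ (hdiv s hs) _ (hdiv t ht), ← sub_div, abs_div,
          abs_of_pos hl, div_mul_cancel₀ _ hl.ne']
      outside := fun t ht => if_neg ht }
  have hmem : dist x y ∈ η.dom := ⟨hl.le, le_rfl⟩
  obtain ⟨γ, hγ, hext⟩ := η.exists_isMaximal_extends
  refine ⟨⟨γ, hγ⟩, hext.1 hmem, (hext.2 hmem).trans ?_⟩
  change (if dist x y ∈ Icc (0 : ℝ) (dist x y) then c (dist x y / dist x y) else x) = y
  rw [if_pos hmem, div_self hl.ne', hc.target]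

/-! ### The exponential map -/

/-- The point `γ(lam s)`, for a pair `(γ, s)` representing a point of the pre-tangent cone. -/
def expMap (lam : ℝ) (p : MaximalGeodesic x × ℝ≥0) : X := p.1.1.toFun (lam * p.2)

theorem expMap_of_eq_zero {p : MaximalGeodesic x × ℝ≥0} (hp : p.2 = 0) (lam : ℝ) :
    expMap lam p = x := by
  simp [expMap, hp, p.1.1.map_zero]

/-- This upper bound is uniform over all pairs, so it also controls points outside a finite net, for
which the scale is not adapted. -/
theorem dist_expMap_le_coneDist {p q : MaximalGeodesic x × ℝ≥0} {lam : ℝ} (h0 : 0 < lam)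
    (h1 : lam ≤ 1) (hp : lam * p.2 ∈ p.1.1.dom) (hq : lam * q.2 ∈ q.1.1.dom) :
    dist (expMap lam p) (expMap lam q) / lam ≤ coneDist p q :=
  le_csSup (bddAbove_scaledDists p q) ⟨lam, h0, h1, hp, hq, rfl⟩

theorem coneDist_le_add (p q : MaximalGeodesic x × ℝ≥0) : coneDist p q ≤ p.2 + q.2 :=
  Real.sSup_le (fun _ h => scaledDists_le h) (by positivity)

theorem eventually_nhdsGT_zero_le {c : ℝ} (hc : 0 < c) : ∀ᶠ lam : ℝ in 𝓝[>] 0, lam ≤ c :=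
  nhdsWithin_le_nhds (eventually_le_nhds hc)

theorem eventually_nhdsGT_zero_pos : ∀ᶠ lam : ℝ in 𝓝[>] 0, 0 < lam := self_mem_nhdsWithin

variable [IsBusemannConcave X]

theorem eventually_mem_dom {y : X} (hy : y ≠ x) (p : MaximalGeodesic x × ℝ≥0) :
    ∀ᶠ lam : ℝ in 𝓝[>] 0, lam * p.2 ∈ p.1.1.dom := by
  obtain ⟨a, ha, ha0⟩ := p.1.2.exists_pos hy
  have h : Tendsto (fun lam : ℝ => lam * p.2) (𝓝[>] 0) (𝓝 0) := by
    have : Tendsto (fun lam : ℝ => lam * p.2) (𝓝 0) (𝓝 (0 * p.2)) :=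
      (continuous_id.mul continuous_const).tendsto 0
    rw [zero_mul] at this
    exact this.mono_left nhdsWithin_le_nhds
  filter_upwards [h.eventually_lt_const ha0, eventually_nhdsGT_zero_pos] with lam h1 h2
  exact p.1.1.mem_of_le ha (mul_nonneg h2.le p.2.2) h1.le

/-- A single scale `r` at which the quotient exceeds `c` suffices: monotonicity passes the bound to
every `lam ≤ r`, with contraction factor `lam / r`. -/
theorem eventually_lt_dist_expMap {y : X} (hy : y ≠ x) (p q : MaximalGeodesic x × ℝ≥0) {c : ℝ}
    (hc : c < coneDist p q) :
    ∀ᶠ lam : ℝ in 𝓝[>] 0, c < dist (expMap lam p) (expMap lam q) / lam := by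
  have hne : (scaledDists p q).Nonempty := by
    obtain ⟨lam, hp, hq, h1, h0⟩ := ((eventually_mem_dom hy p).and ((eventually_mem_dom hy q).and
      ((eventually_nhdsGT_zero_le one_pos).and eventually_nhdsGT_zero_pos))).exists
    exact ⟨_, lam, h0, h1, hp, hq, rfl⟩
  obtain ⟨_, ⟨r, hr, -, hp, hq, rfl⟩, hlt⟩ := exists_lt_of_lt_csSup hne hc
  filter_upwards [eventually_nhdsGT_zero_le hr, eventually_nhdsGT_zero_pos] with lam h1 h0
  have h := scaledDist_antitone p.1.1 q.1.1 hr hp hq (div_pos h0 hr) ((div_le_one hr).2 h1)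
  rw [div_mul_cancel₀ _ hr.ne'] at h
  exact hlt.trans_le h

theorem coneDist_of_eq_zero_left {y : X} (hy : y ≠ x) (p q : MaximalGeodesic x × ℝ≥0)
    (hp : p.2 = 0) : coneDist p q = q.2 := by
  refine le_antisymm ((coneDist_le_add p q).trans_eq (by simp [hp])) ?_
  obtain ⟨lam, h0, h1, hq⟩ := (eventually_nhdsGT_zero_pos.and
    ((eventually_nhdsGT_zero_le one_pos).and (eventually_mem_dom hy q))).exists
  have h := dist_expMap_le_coneDist (p := p) h0 h1 (by simp [hp, p.1.1.zero_mem]) hq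
  rwa [expMap_of_eq_zero hp, expMap, q.1.1.dist_base hq, mul_div_cancel_left₀ _ h0.ne'] at h

end Cone

/-! ### Finite nets -/

/-- Iterating the doubling condition: small balls around `x` are covered by a bounded number of
balls of a radius smaller by a given factor. -/
theorem IsLocallyDoubling.exists_cover {X : Type u} [MetricSpace X] (hX : IsLocallyDoubling X)
    (x : X) : ∃ R : ℝ, 0 < R ∧ ∀ k : ℕ, ∃ M : ℕ, ∀ r : ℝ, 0 < r → r ≤ R →
      ∃ s : Finset X, s.card ≤ M ∧ Metric.ball x r ⊆ ⋃ z ∈ s, Metric.ball z (r / 2 ^ k) := by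
  classical
  obtain ⟨R, hR, N, hN⟩ := hX x
  -- The margin `4 * r` survives the induction: a new center satisfies `dist z y < 3 / 2 * r`, and
  -- `3 / 2 * r + 4 * (r / 2) ≤ 4 * r`.
  have key (k : ℕ) : ∃ M : ℕ, ∀ (y : X) (r : ℝ), 0 < r → dist y x + 4 * r ≤ R →
      ∃ s : Finset X, s.card ≤ M ∧ Metric.ball y r ⊆ ⋃ z ∈ s, Metric.ball z (r / 2 ^ k) := by
    induction k with
    | zero => exact ⟨1, fun y r _ _ => ⟨{y}, by simp, by simp⟩⟩
    | succ k ih =>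
      obtain ⟨M, hM⟩ := ih
      refine ⟨N * M, fun y r hr hyr => ?_⟩
      have hd : 0 ≤ dist y x := dist_nonneg
      obtain ⟨s, hs, hcov⟩ := hN y (by rw [Metric.mem_ball]; linarith) r hr (by linarith)
      have hz (z : X) : ∃ t : Finset X, t.card ≤ M ∧
          (dist z y < 3 / 2 * r → Metric.ball z (r / 2) ⊆
            ⋃ w ∈ t, Metric.ball w (r / 2 / 2 ^ k)) := by
        by_cases h : dist z y < 3 / 2 * r
        · have := dist_triangle z y x
          obtain ⟨t, ht, ht'⟩ := hM z (r / 2) (half_pos hr) (by linarith)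
          exact ⟨t, ht, fun _ => ht'⟩
        -- Balls of radius `r / 2` around such far centers miss the ball around `y` and can be
        -- dropped.
        · exact ⟨∅, by simp, fun h' => absurd h' h⟩
      choose t ht ht' using hz
      refine ⟨s.biUnion t, (Finset.card_biUnion_le_card_mul s t M fun z _ => ht z).trans
        (Nat.mul_le_mul_right M hs), fun w hw => ?_⟩
      obtain ⟨z, hzs, hwz⟩ := mem_iUnion₂.1 (hcov hw)
      have hzy : dist z y < 3 / 2 * r := by
        have := dist_triangle_left z y w
        rw [Metric.mem_ball] at hw hwz
        linarith
      obtain ⟨v, hv, hwv⟩ := mem_iUnion₂.1 (ht' z hzy hwz)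
      refine mem_iUnion₂.2 ⟨v, Finset.mem_biUnion.2 ⟨z, hzs, hv⟩, ?_⟩
      rwa [pow_succ', ← div_div]
  refine ⟨R / 4, by positivity, fun k => ?_⟩
  obtain ⟨M, hM⟩ := key k
  exact ⟨M, fun r hr hrR => hM x r hr (by rw [dist_self]; linarith)⟩

section Net

variable {X : Type u} [MetricSpace X] [IsBusemannConcave X] {x : X}

/-- The number of points of a separated subset of a ball of the pre-tangent cone is bounded. -/
theorem exists_card_le_of_separated (hX : IsLocallyDoubling X) {y : X} (hy : y ≠ x) {r ε : ℝ}
    (hr : 0 < r) (hε : 0 < ε) : ∃ M : ℕ, ∀ F : Finset (MaximalGeodesic x × ℝ≥0),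
      (∀ p ∈ F, (p.2 : ℝ) < r) → (∀ p ∈ F, ∀ q ∈ F, p ≠ q → ε ≤ coneDist p q) → F.card ≤ M := by
  obtain ⟨R, hR, hcov⟩ := hX.exists_cover x
  -- This makes the covering radius less than `lam * ε / 4`, so a covering ball cannot contain two
  -- image points that are more than `lam * ε / 2` apart.
  obtain ⟨k, hk⟩ : ∃ k : ℕ, r * 4 / ε < 2 ^ k := pow_unbounded_of_one_lt _ one_lt_two
  obtain ⟨M, hM⟩ := hcov k
  refine ⟨M, fun F hF hsep => ?_⟩
  have hev : ∀ᶠ lam : ℝ in 𝓝[>] 0, lam ≤ R / r ∧ (∀ p ∈ F, lam * p.2 ∈ p.1.1.dom) ∧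
      ∀ p ∈ F, ∀ q ∈ F, p ≠ q → ε / 2 < dist (expMap lam p) (expMap lam q) / lam := by
    refine (eventually_nhdsGT_zero_le (div_pos hR hr)).and
      (((Finset.eventually_all F).2 fun p _ => eventually_mem_dom hy p).and
      ((Finset.eventually_all F).2 fun p hp => (Finset.eventually_all F).2 fun q hq => ?_))
    by_cases hpq : p = q
    · exact Eventually.of_forall fun _ h => absurd hpq h
    · filter_upwards [eventually_lt_dist_expMap hy p q
        ((half_lt_self hε).trans_le (hsep p hp q hq hpq))] with lam h _ using h
  obtain ⟨lam, ⟨hlam, hdom, hd⟩, h0⟩ := (hev.and eventually_nhdsGT_zero_pos).exists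
  obtain ⟨s, hs, hcov⟩ := hM (lam * r) (by positivity) ((le_div_iff₀ hr).1 hlam)
  have hz : ∀ p ∈ F, ∃ z ∈ s, expMap lam p ∈ Metric.ball z (lam * r / 2 ^ k) := fun p hp => by
    have : expMap lam p ∈ Metric.ball x (lam * r) := by
      rw [Metric.mem_ball, dist_comm, expMap, p.1.1.dist_base (hdom p hp)]
      exact mul_lt_mul_of_pos_left (hF p hp) h0
    simpa using hcov this
  have : Nonempty X := ⟨x⟩
  choose! f hfs hf using hz
  refine (Finset.card_le_card_of_injOn f hfs fun p hp q hq hpq => ?_).trans hs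
  by_contra hne
  have h1 := hd p hp q hq hne
  have h2 := hf p hp
  have h3 := hf q hq
  rw [← hpq] at h3
  rw [Metric.mem_ball] at h2 h3
  have h4 := dist_triangle_right (expMap lam p) (expMap lam q) (f p)
  rw [lt_div_iff₀ h0] at h1
  have h5 : lam * r / 2 ^ k < lam * (ε / 4) := by
    rw [div_lt_iff₀ hε] at hk
    rw [div_lt_iff₀ (by positivity)]
    nlinarith
  linarith

/-- Balls of the pre-tangent cone have finite nets. -/
theorem exists_finite_net (hX : IsLocallyDoubling X) {y : X} (hy : y ≠ x) {r ε : ℝ}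
    (hr : 0 < r) (hε : 0 < ε) : ∃ F : Finset (MaximalGeodesic x × ℝ≥0),
      (∀ p ∈ F, (p.2 : ℝ) < r) ∧ ∀ q : MaximalGeodesic x × ℝ≥0, (q.2 : ℝ) < r →
        ∃ p ∈ F, coneDist q p < ε := by
  classical
  obtain ⟨M, hM⟩ := exists_card_le_of_separated hX hy hr hε
  -- Without a finite net, separated sets can be enlarged one point at a time beyond the bound `M`.
  by_contra! hcon
  have key (n : ℕ) : ∃ F : Finset (MaximalGeodesic x × ℝ≥0), (∀ p ∈ F, (p.2 : ℝ) < r) ∧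
      (∀ p ∈ F, ∀ q ∈ F, p ≠ q → ε ≤ coneDist p q) ∧ F.card = n := by
    induction n with
    | zero => exact ⟨∅, by simp, by simp, rfl⟩
    | succ n ih =>
      obtain ⟨F, hF, hsep, hcard⟩ := ih
      obtain ⟨q, hq, hqF⟩ := hcon F hF
      have hqm : q ∉ F := fun h => (hqF q h).not_gt (by rwa [coneDist_self])
      refine ⟨insert q F, ?_, ?_, by rw [Finset.card_insert_of_notMem hqm, hcard]⟩
      · simpa [hq] using hF
      · intro p hp p' hp' hne
        rcases Finset.mem_insert.1 hp with rfl | hpF <;>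
          rcases Finset.mem_insert.1 hp' with rfl | hpF'
        · exact absurd rfl hne
        · exact hqF p' hpF'
        · rw [coneDist_comm]; exact hqF p hpF
        · exact hsep p hpF p' hpF' hne
  obtain ⟨F, hF, hsep, hcard⟩ := key (M + 1)
  have := hM F hF hsep
  omega

/-! ### The tangent cone as a limit -/

/-- The point of the pre-tangent cone represented by a pair `(γ, s)`. -/
def PreTangentCone.mk (p : MaximalGeodesic x × ℝ≥0) : PreTangentCone x :=
  Quotient.mk (tipSetoid x) p

/-- The point of the tangent cone represented by a pair `(γ, s)`. -/
noncomputable def TangentCone.mk (p : MaximalGeodesic x × ℝ≥0) : TangentCone x :=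
  UniformSpace.Completion.coe' (PreTangentCone.mk p)

theorem TangentCone.dist_mk (p q : MaximalGeodesic x × ℝ≥0) :
    dist (TangentCone.mk p) (TangentCone.mk q) = coneDist p q :=
  UniformSpace.Completion.dist_eq _ _

theorem TangentCone.denseRange_mk : DenseRange (TangentCone.mk (x := x)) :=
  have h : Function.Surjective (PreTangentCone.mk (x := x)) := Quotient.mk_surjective
  UniformSpace.Completion.denseRange_coe.comp h.denseRange
    (UniformSpace.Completion.continuous_coe _)

theorem TangentCone.dist_mk_tip {y : X} (hy : y ≠ x) (p : MaximalGeodesic x × ℝ≥0) :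
    dist (TangentCone.mk p) (TangentCone.tip x) = p.2 := by
  rw [dist_comm]
  exact (TangentCone.dist_mk (Classical.arbitrary _, 0) p).trans
    (coneDist_of_eq_zero_left hy _ p rfl)

theorem TangentCone.exists_finite_net (hX : IsLocallyDoubling X) {y : X} (hy : y ≠ x) {r ε : ℝ}
    (hr : 0 < r) (hε : 0 < ε) : ∃ F : Finset (MaximalGeodesic x × ℝ≥0),
      (∀ p ∈ F, (p.2 : ℝ) < r) ∧ ∀ c ∈ Metric.ball (TangentCone.tip x) r,
        ∃ p ∈ F, dist c (TangentCone.mk p) < ε := by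
  obtain ⟨F, hF, hnet⟩ := BusemannTangent.exists_finite_net hX hy hr (half_pos hε)
  refine ⟨F, hF, fun c hc => ?_⟩
  -- Since the ball of radius `r` is open, the approximating point of the pre-tangent cone can be
  -- taken inside it.
  obtain ⟨q, hq1, hq2⟩ := TangentCone.denseRange_mk.exists_mem_open
    (Metric.isOpen_ball.inter Metric.isOpen_ball) ⟨c, hc, Metric.mem_ball_self (half_pos hε)⟩
  rw [Metric.mem_ball, TangentCone.dist_mk_tip hy] at hq1
  obtain ⟨p, hp, hqp⟩ := hnet q hq1
  refine ⟨p, hp, ?_⟩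
  rw [← TangentCone.dist_mk] at hqp
  rw [Metric.mem_ball] at hq2
  linarith [dist_triangle_left c (TangentCone.mk p) (TangentCone.mk q)]

theorem TangentCone.subsingleton_of_forall_eq (h : ∀ y : X, y = x) :
    Subsingleton (TangentCone x) := by
  have h0 (p q : MaximalGeodesic x × ℝ≥0) : coneDist p q = 0 := by
    -- This form of the bound also covers an empty set of scaled distances, whose supremum is `0`.
    refine le_antisymm (Real.sSup_le ?_ le_rfl) (coneDist_nonneg p q)
    rintro _ ⟨r, -, -, -, -, rfl⟩
    rw [h (p.1.1.toFun _), h (q.1.1.toFun _), dist_self, zero_div]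
  refine ⟨fun a b => dist_eq_zero.1 ?_⟩
  induction a, b using UniformSpace.Completion.induction_on₂ with
  | hp => exact isClosed_eq continuous_dist continuous_const
  | ih a b =>
    rw [UniformSpace.Completion.dist_eq]
    induction a, b using Quotient.inductionOn₂ with
    | h p q => exact h0 p q

theorem TangentCone.properSpace (hX : IsLocallyDoubling X) (x : X) :
    ProperSpace (TangentCone x) := by
  by_cases h : ∀ y : X, y = x
  · have := TangentCone.subsingleton_of_forall_eq h
    infer_instance
  · push Not at h
    obtain ⟨y, hy⟩ := h
    refine properSpace_of_totallyBounded_ball (TangentCone.tip x) fun r hr => ?_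
    rw [Metric.totallyBounded_iff]
    intro ε hε
    obtain ⟨F, -, hF⟩ := TangentCone.exists_finite_net hX hy hr hε
    refine ⟨image TangentCone.mk F, F.finite_toSet.image _, fun c hc => ?_⟩
    obtain ⟨p, hp, hcp⟩ := hF c hc
    exact mem_iUnion₂.2 ⟨_, mem_image_of_mem _ hp, hcp⟩

/-- If the pairs in the finite set `F` form a `δ`-net of the ball of the tangent cone and the
exponential map at scale `lam` almost preserves their distances, then the balls of the blow-up and
of the tangent cone are close. -/
theorem ballsClose_blowup_of_net {y : X} (hy : y ≠ x) {r δ : ℝ} (hδ : 0 < δ)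
    {lam : Ioi (0 : ℝ)} (hlam : (lam : ℝ) ≤ 1) {F : Finset (MaximalGeodesic x × ℝ≥0)}
    (hF : ∀ p ∈ F, (p.2 : ℝ) < r) (h0 : ∃ p ∈ F, p.2 = 0)
    (hnet : ∀ c ∈ Metric.ball (TangentCone.tip x) r, ∃ p ∈ F, dist c (TangentCone.mk p) < δ)
    (hdom : ∀ p ∈ F, (lam : ℝ) * p.2 ∈ p.1.1.dom)
    (hdist : ∀ p ∈ F, ∀ q ∈ F,
      coneDist p q - δ < dist (expMap (lam : ℝ) p) (expMap lam q) / lam) :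
    BallsClose (⟨x⟩ : Blowup X lam) (TangentCone.tip x) r (5 * δ) := by
  have hl : (0 : ℝ) < lam := lam.2
  have hblow (p q : Blowup X lam) : dist p q = dist p.val q.val / (lam : ℝ) := rfl
  have hup : ∀ p ∈ F, ∀ q ∈ F,
      dist (⟨expMap lam p⟩ : Blowup X lam) ⟨expMap lam q⟩ ≤ coneDist p q := fun p hp q hq =>
    dist_expMap_le_coneDist hl hlam (hdom p hp) (hdom q hq)
  -- Points are related through a common net index. Moving two points to the net costs `2 * δ` on
  -- each side, and the net itself is distorted by at most `δ`, whence `5 * δ`.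
  refine ⟨fun p c => ∃ i ∈ F, dist c (TangentCone.mk i) < δ ∧ dist p ⟨expMap lam i⟩ < δ,
    ?_, fun p hp => ?_, fun c hc => ?_, ?_⟩
  · obtain ⟨i, hi, hi0⟩ := h0
    refine ⟨i, hi, ?_, ?_⟩
    · rwa [dist_comm, TangentCone.dist_mk_tip hy, hi0]
    · rwa [expMap_of_eq_zero hi0, dist_self]
  · obtain ⟨γ, hγ, hγp⟩ := exists_maximalGeodesic_through x p.val
    -- A preimage of `p` under the exponential map. It need not lie in `F`, but the non-expanding
    -- property sends it within `δ` of the image of its nearby net point.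
    let q : MaximalGeodesic x × ℝ≥0 := (γ, ⟨dist x p.val / lam, by positivity⟩)
    have hq : (lam : ℝ) * q.2 = dist x p.val := mul_div_cancel₀ _ hl.ne'
    have hqr : (q.2 : ℝ) < r := by
      rw [Metric.mem_ball, dist_comm, hblow] at hp
      exact hp
    obtain ⟨i, hi, hqi⟩ := hnet (TangentCone.mk q)
      (by rwa [Metric.mem_ball, TangentCone.dist_mk_tip hy])
    refine ⟨TangentCone.mk i, ?_, i, hi, by rwa [dist_self], ?_⟩
    · rw [Metric.mem_ball, TangentCone.dist_mk_tip hy]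
      exact hF i hi
    · have h := dist_expMap_le_coneDist (p := q) hl hlam (by rw [hq]; exact hγ) (hdom i hi)
      have he : expMap lam q = p.val := by rw [expMap, hq]; exact hγp
      rw [he] at h
      rw [TangentCone.dist_mk] at hqi
      exact h.trans_lt hqi
  · obtain ⟨i, hi, hci⟩ := hnet c hc
    refine ⟨⟨expMap lam i⟩, ?_, i, hi, hci, by rwa [dist_self]⟩
    rw [Metric.mem_ball, dist_comm, hblow, div_lt_iff₀ hl, mul_comm]
    change dist x (i.1.1.toFun (lam * i.2)) < _
    rw [i.1.1.dist_base (hdom i hi)]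
    exact mul_lt_mul_of_pos_left (hF i hi) hl
  · rintro p c p' c' ⟨i, hi, hci, hpi⟩ ⟨j, hj, hcj, hpj⟩
    have h1 := hup i hi j hj
    have h2 : coneDist i j - δ < dist (⟨expMap lam i⟩ : Blowup X lam) ⟨expMap lam j⟩ :=
      hdist i hi j hj
    rw [← TangentCone.dist_mk] at h1 h2
    have h3 := abs_le.1 ((dist_dist_dist_le p p' (⟨expMap lam i⟩ : Blowup X lam)
      ⟨expMap lam j⟩).trans (add_le_add hpi.le hpj.le))
    have h4 := abs_le.1 ((dist_dist_dist_le c c' (TangentCone.mk i)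
      (TangentCone.mk j)).trans (add_le_add hci.le hcj.le))
    rw [abs_le]
    constructor <;> linarith [h3.1, h3.2, h4.1, h4.2]

theorem pointedGHTendsto_tangentCone (hX : IsLocallyDoubling X) (x : X) :
    PointedGHTendsto (fun lam : Ioi (0 : ℝ) => Blowup X lam) (fun lam => (⟨x⟩ : Blowup X lam))
      (comap (fun lam : Ioi (0 : ℝ) => (lam : ℝ)) (𝓝 0)) (TangentCone x) (TangentCone.tip x) := by
  classical
  rw [pointedGHTendsto_iff]
  intro r hr ε hε
  by_cases h : ∀ y : X, y = x
  · have := TangentCone.subsingleton_of_forall_eq h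
    have hsub (lam : Ioi (0 : ℝ)) (p q : Blowup X lam) : p = q :=
      Blowup.ext ((h p.val).trans (h q.val).symm)
    refine Eventually.of_forall fun lam => ⟨fun _ _ => True, trivial,
      fun _ _ => ⟨_, Metric.mem_ball_self hr, trivial⟩,
      fun _ _ => ⟨_, Metric.mem_ball_self hr, trivial⟩, fun p c p' c' _ _ => ?_⟩
    rw [hsub lam p p', Subsingleton.elim c c', dist_self, dist_self, sub_zero, abs_zero]
    exact hε.le
  · push Not at h
    obtain ⟨y, hy⟩ := h
    have hδ : 0 < ε / 5 := by positivity
    obtain ⟨F, hF, hnet⟩ := TangentCone.exists_finite_net hX hy hr hδ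
    let o : MaximalGeodesic x × ℝ≥0 := (Classical.arbitrary _, 0)
    -- The tip is added to the net so that the base points are related.
    let G := insert o F
    have hev : ∀ᶠ lam : ℝ in 𝓝[>] 0, lam ≤ 1 ∧ (∀ p ∈ G, lam * p.2 ∈ p.1.1.dom) ∧
        ∀ p ∈ G, ∀ q ∈ G,
          coneDist p q - ε / 5 < dist (expMap lam p) (expMap lam q) / lam :=
      (eventually_nhdsGT_zero_le one_pos).and
        (((Finset.eventually_all G).2 fun p _ => eventually_mem_dom hy p).and
        ((Finset.eventually_all G).2 fun p _ => (Finset.eventually_all G).2 fun q _ =>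
          eventually_lt_dist_expMap hy p q (sub_lt_self _ hδ)))
    have ht : Tendsto (fun lam : Ioi (0 : ℝ) => (lam : ℝ))
        (comap (fun lam : Ioi (0 : ℝ) => (lam : ℝ)) (𝓝 0)) (𝓝[>] 0) :=
      tendsto_nhdsWithin_iff.2 ⟨tendsto_comap, Eventually.of_forall fun lam => lam.2⟩
    filter_upwards [ht.eventually hev] with lam ⟨h1, h2, h3⟩
    have := ballsClose_blowup_of_net (r := r) hy hδ h1 (F := G) (by simpa [G, o, hr] using hF)
      ⟨o, Finset.mem_insert_self _ _, rfl⟩ (fun c hc => ?_) h2 h3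
    · rwa [mul_div_cancel₀ _ (by norm_num)] at this
    · obtain ⟨p, hp, hcp⟩ := hnet c hc
      exact ⟨p, Finset.mem_insert_of_mem hp, hcp⟩

end Net

end BusemannTangent

theorem mainTheorem10 {X : Type u} [MetricSpace X] [CompleteSpace X]
    [BusemannTangent.IsBusemannConcave X] (hX : BusemannTangent.IsLocallyDoubling X) (x : X) :
    LocallyCompactSpace (BusemannTangent.TangentCone x) ∧
    BusemannTangent.PointedGHTendsto (fun lam : Ioi (0 : ℝ) => BusemannTangent.Blowup X lam)
      (fun lam => (⟨x⟩ : BusemannTangent.Blowup X lam))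
      (comap (fun lam : Ioi (0 : ℝ) => (lam : ℝ)) (𝓝 0))
      (BusemannTangent.TangentCone x) (BusemannTangent.TangentCone.tip x) ∧
    ∀ (Y : Type v) [MetricSpace Y] [CompleteSpace Y] (y : Y) (lam : ℕ → Ioi (0 : ℝ)),
      Tendsto (fun n => (lam n : ℝ)) atTop (𝓝 0) →
      BusemannTangent.PointedGHTendsto (fun n => BusemannTangent.Blowup X (lam n))
        (fun n => (⟨x⟩ : BusemannTangent.Blowup X (lam n))) atTop Y y →
      ∃ e : BusemannTangent.TangentCone x ≃ᵢ Y, e (BusemannTangent.TangentCone.tip x) = y := by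
  have hproper := BusemannTangent.TangentCone.properSpace hX x
  have hlim := BusemannTangent.pointedGHTendsto_tangentCone hX x
  refine ⟨inferInstance, hlim, fun Y _ _ y lam hlam hY => ?_⟩
  rw [BusemannTangent.pointedGHTendsto_iff] at hlim hY
  -- Both spaces are compared with one blow-up `X` at scale `lam n`, with `n` depending on `r` and
  -- `ε`.
  have hclose : ∀ r : ℝ, 0 < r → ∀ ε : ℝ, 0 < ε →
      BusemannTangent.BallsClose (BusemannTangent.TangentCone.tip x) y r ε := by
    intro r hr ε hε
    have hlam' : Tendsto lam atTop (comap (fun lam : Ioi (0 : ℝ) => (lam : ℝ)) (𝓝 0)) :=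
      tendsto_comap_iff.2 hlam
    obtain ⟨n, h1, h2⟩ := ((hlam'.eventually (hlim r hr (ε / 2) (half_pos hε))).and
      (hY r hr (ε / 2) (half_pos hε))).exists
    have := h1.symm.trans h2
    rwa [add_halves] at this
  -- Only completeness of `Y` is given; its properness is inherited from the tangent cone.
  have := BusemannTangent.properSpace_of_ballsClose hclose
  exact BusemannTangent.exists_isometryEquiv_of_ballsClose hclose
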